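/- A Dyck path of semilength $n$ is a lattice path from $(0,0)$ to $(2n,0)$ with steps $U=(1,1)$, $D=(1,-1)$ that never goes below the $x$-axis; it is prime if it is nonempty and touches the $x$-axis only at its two ends. Let $\mathcal S_n$ be the set of Dyck paths of semilength $n$ ordered by the reflexive transitive closure $\le$ of the relation $P\to P'$, where $P'$ arises from $P$ by replacing one occurrence of $DU^kD^k$ $(k\ge 1)$ by $U^kD^kD$. For $n,k\ge1$ let $a_{n,k}$ be the number of intervals of $\mathcal S_n$, i.e. of pairs $(P,Q)$ with $P\le Q$ in $\mathcal S_n$, such that the last run of down-steps of $Q$ has length exactly $k$, and let $b_{n,k}$ be the number of those for which in addition $Q$ is prime. Put $$I(x,y)=\sum_{n,k\ge1}a_{n,k}x^ny^k,\qquad J(x,y)=\sum_{n,k\ge1}b_{n,k}x^ny^k,$$ formal power series in $x$ with coefficients in $\mathbb Q[y]$, and let $C(x)=\sum_{n\ge0}\frac{1}{n+1}\binom{2n}{n}x^n$ be the Catalan generating function, so that $C(x)=1+xC(x)^2$. Theorem. We have $$J(x,y)=\frac{xy\,\bigl(-1+J(x,1)\bigr)\bigl(J(x,1)\,C(xy)\,y-y+1\bigr)}{J(x,1)\,C(xy)\,xy^2-C(xy)\,xy^2-xy^2-J(x,1)\,y+xy+J(x,1)+y-1},$$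 where the denominator is nonzero and $$J(x,1)=\frac{1-\sqrt{1-8x}}{4},$$ $\sqrt{1-8x}$ being the formal power series with constant term $1$ and square $1-8x$. Moreover, $I$ and $J$ satisfy the system $$I(x,y)=\frac{J(x,y)}{1-J(x,1)},\qquad J(x,y)=xy+xy\,I(x,y)+\frac{J(x,y)-J(x,1)}{y-1}\cdot C(xy)\,xy^2.$$ -/

import Mathlib

namespace DyckInterval

/-- `𝒟ₙ`: Dyck paths of semilength `n`. -/
abbrev Path (n : ℕ) : Type := {p : DyckWord // p.semilength = n}

/-- The covering relation `P ⟶ Q`: an occurrence of `D Uᵏ Dᵏ` (`k ≥ 1`) in `P` is replaced by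
`Uᵏ Dᵏ D`. -/
def Covers {n : ℕ} (P Q : Path n) : Prop :=
  ∃ (A B : List DyckStep) (k : ℕ), 1 ≤ k ∧
    P.1.toList = A ++ ([DyckStep.D] ++ List.replicate k DyckStep.U
      ++ List.replicate k DyckStep.D) ++ B ∧
    Q.1.toList = A ++ (List.replicate k DyckStep.U ++ List.replicate k DyckStep.D
      ++ [DyckStep.D]) ++ B

/-- The order `P ≤ Q` of the poset `𝒮ₙ`: the reflexive transitive closure of the covering
relation. -/
def Le {n : ℕ} (P Q : Path n) : Prop := Relation.ReflTransGen Covers P Q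

/-- The number of down-steps in the last (maximal, terminal) run of down-steps. -/
def lastDownRun (P : DyckWord) : ℕ :=
  (P.toList.rtakeWhile (fun s => decide (s = DyckStep.D))).length

/-- A prime Dyck path is nonempty and touches the axis only at its two ends. -/
abbrev IsPrime (P : DyckWord) : Prop := P.IsNested

open Classical in
/-- The intervals `(P, Q)`, `P ≤ Q`, of `𝒮ₙ` whose upper path `Q` ends with exactly `k`
down-steps. -/
noncomputable def intervals (n k : ℕ) : Finset (Path n × Path n) :=
  {I | Le I.1 I.2 ∧ lastDownRun I.2.1 = k}

open Classical in
/-- The intervals `(P, Q)` of `𝒮ₙ` whose upper path `Q` is prime and ends with exactly `k`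
down-steps. -/
noncomputable def primeIntervals (n k : ℕ) : Finset (Path n × Path n) :=
  {I | Le I.1 I.2 ∧ IsPrime I.2.1 ∧ lastDownRun I.2.1 = k}

theorem lastDownRun_le {n : ℕ} (P : Path n) : lastDownRun P.1 ≤ n := by
  have h : (P.1.toList.rtakeWhile (fun s => decide (s = DyckStep.D))).count DyckStep.D
      = (P.1.toList.rtakeWhile (fun s => decide (s = DyckStep.D))).length := by
    rw [List.count_eq_length]
    intro b hb
    have := List.mem_rtakeWhile_imp hb
    simpa using (of_decide_eq_true this).symm
  have h2 := (List.rtakeWhile_suffix (fun s => decide (s = DyckStep.D))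
    P.1.toList).sublist.count_le DyckStep.D
  have h3 := P.1.semilength_eq_count_D
  have h4 := P.2
  unfold lastDownRun
  omega

/-! Bivariate generating functions `∑ f(n,k) xⁿ yᵏ` are power series in `x` whose coefficients are
polynomials in `y` (for each `n` only `k ≤ n` occurs), so that `y = 1` can be substituted. -/

/-- `I(x,y) = ∑_{n,k ≥ 1} a_{n,k} xⁿ yᵏ`. -/
noncomputable def I : PowerSeries (Polynomial ℚ) :=
  PowerSeries.mk fun n => ∑ k ∈ Finset.Icc 1 n, Polynomial.monomial k ((intervals n k).card : ℚ)

/-- `J(x,y) = ∑_{n,k ≥ 1} b_{n,k} xⁿ yᵏ`. -/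
noncomputable def J : PowerSeries (Polynomial ℚ) :=
  PowerSeries.mk fun n =>
    ∑ k ∈ Finset.Icc 1 n, Polynomial.monomial k ((primeIntervals n k).card : ℚ)

/-- Every `a_{n,k}` with `n, k ≥ 1` is a coefficient of `I` (the range `k ≤ n` loses nothing). -/
theorem coeff_I (n k : ℕ) (hk : 1 ≤ k) :
    (PowerSeries.coeff n I).coeff k = ((intervals n k).card : ℚ) := by
  simp only [I, PowerSeries.coeff_mk, Polynomial.finsetSum_coeff, Polynomial.coeff_monomial,
    Finset.sum_ite_eq', Finset.mem_Icc]
  split_ifs with h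
  · rfl
  · symm
    classical
    rw [Nat.cast_eq_zero, Finset.card_eq_zero, intervals, Finset.filter_eq_empty_iff]
    rintro ⟨P, Q⟩ - ⟨-, h2⟩
    exact h ⟨hk, h2 ▸ lastDownRun_le Q⟩

/-- Every `b_{n,k}` with `n, k ≥ 1` is a coefficient of `J`. -/
theorem coeff_J (n k : ℕ) (hk : 1 ≤ k) :
    (PowerSeries.coeff n J).coeff k = ((primeIntervals n k).card : ℚ) := by
  simp only [J, PowerSeries.coeff_mk, Polynomial.finsetSum_coeff, Polynomial.coeff_monomial,
    Finset.sum_ite_eq', Finset.mem_Icc]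
  split_ifs with h
  · rfl
  · symm
    classical
    rw [Nat.cast_eq_zero, Finset.card_eq_zero, primeIntervals, Finset.filter_eq_empty_iff]
    rintro ⟨P, Q⟩ - ⟨-, -, h2⟩
    exact h ⟨hk, h2 ▸ lastDownRun_le Q⟩

/-- The variable `x`. -/
noncomputable def x : PowerSeries (Polynomial ℚ) := PowerSeries.X

/-- The variable `y`. -/
noncomputable def y : PowerSeries (Polynomial ℚ) := PowerSeries.C Polynomial.X

/-- Substitution `y = 1`: `F(x,y) ↦ F(x,1)`. -/
noncomputable def atOne : PowerSeries (Polynomial ℚ) →+* PowerSeries ℚ :=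
  PowerSeries.map (Polynomial.evalRingHom 1)

/-- A series in `x` regarded as a series in `x` and `y`. -/
noncomputable def lift : PowerSeries ℚ →+* PowerSeries (Polynomial ℚ) :=
  PowerSeries.map Polynomial.C

/-- `C(xy) = ∑ cₙ xⁿ yⁿ`, where `cₙ` are the Catalan numbers. -/
noncomputable def Cxy : PowerSeries (Polynomial ℚ) :=
  PowerSeries.rescale Polynomial.X
    (PowerSeries.map (Nat.castRingHom (Polynomial ℚ)) PowerSeries.catalanSeries)

/-- The formal power series `√(1 - 8x) = ∑ binom(1/2, n) (-8x)ⁿ`. -/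
noncomputable def sqrtOneSubEightX : PowerSeries ℚ :=
  PowerSeries.rescale (-8 : ℚ) (PowerSeries.binomialSeries ℚ (1 / 2 : ℚ))

theorem sqrtOneSubEightX_sq : sqrtOneSubEightX ^ 2 = 1 - 8 * PowerSeries.X := by
  have h : PowerSeries.binomialSeries ℚ (1 / 2 : ℚ) ^ 2 = 1 + PowerSeries.X := by
    rw [sq, ← PowerSeries.binomialSeries_add]
    have := PowerSeries.binomialSeries_nat (R := ℚ) (A := ℚ) 1
    norm_num at this ⊢
    exact this
  rw [sqrtOneSubEightX, ← map_pow, h, map_add, map_one, PowerSeries.rescale_X]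
  simp [sub_eq_add_neg, map_ofNat (PowerSeries.C (R := ℚ)) 8]

theorem constantCoeff_sqrtOneSubEightX :
    PowerSeries.constantCoeff sqrtOneSubEightX = 1 := by
  rw [sqrtOneSubEightX, ← PowerSeries.coeff_zero_eq_constantCoeff_apply, PowerSeries.coeff_rescale]
  simp

end DyckInterval

/-! A covering step carries one down-step to the right over a pyramid `U^k D^k`, so heights only
increase along `≤`. In the code this lowers one entry and raises a later run by one. The head of a
code is the last run of down-steps, and `l₁ ++ l₂` is the path of `l₂` followed by that of `l₁`.

Since heights only increase, `P` touches the axis wherever `Q` does. Hence an interval below a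
concatenation is a pair of intervals (`CodeLe.of_append_target`). Splitting off the last prime
factor of `Q` gives `I = J (1 + I(x,1))`, which is the first equation.

Let `Q` be prime. If `P` is prime, both ends are wrapped paths and the interval comes from an
arbitrary smaller one; this gives `xy(1 + I)`. Otherwise let `R` be the last prime factor of `P` and
`p` the nonempty rest. A down-step of `p` can cross `R` only once `R` has become a pyramid, and
later steps only change how many down-steps follow that pyramid or change the rest. So `Q` is a
prime `q ≥ p` with a pyramid inserted before its last `c` down-steps, `1 ≤ c ≤ k`, where `k` is the
last run of `q` (`CodeLe.of_prime_append`). Only the size of `R` matters, whence the Catalan factor;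
the sum over `c` is a geometric sum, whence the divided difference.

Eliminating `I` leaves a kernel equation relating `J` and `J(x,1)`, whose rearrangement is the
rational formula. To find `J(x,1)`, put `T = (1 - √(1-8x))/4`, so that `x = T(1-2T)`. With `C =
C(xy)`, the series `(C-1)(1-T)(1-2TC)/(1-2TC-xC³)` solves the equation and becomes `T` at `y = 1`.
An `x`-adic induction shows that the solution is unique. -/

namespace DyckInterval

/-! ### Codes

A Dyck path is encoded by the lengths of the (possibly empty) runs of down-steps that follow its
up-steps, listed from the last up-step to the first one. -/

/-- Every suffix of the code has sum at most its length. -/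
def Ballot : List ℕ → Prop
  | [] => True
  | a :: l => a + l.sum ≤ l.length + 1 ∧ Ballot l

/-- Every nonempty suffix of the code has sum less than its length. -/
def StrictBallot : List ℕ → Prop
  | [] => True
  | a :: l => a + l.sum ≤ l.length ∧ StrictBallot l

/-- Codes of Dyck paths. -/
def IsDyckCode (l : List ℕ) : Prop := Ballot l ∧ l.sum = l.length

/-- Codes of prime Dyck paths. -/
def IsPrimeCode (l : List ℕ) : Prop := l ≠ [] ∧ StrictBallot l.tail ∧ l.sum = l.length

/-- Add one to the first entry. -/
def incHead : List ℕ → List ℕ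
  | [] => []
  | a :: l => (a + 1) :: l

/-- The code of `U P D`, given the code of `P`. -/
def wrap (l : List ℕ) : List ℕ := incHead (l ++ [0])

/-- `Borrow j l l'`: the first nonzero entry of `l` is at position `j` and is lowered by one. -/
inductive Borrow : ℕ → List ℕ → List ℕ → Prop
  | here (a : ℕ) (l : List ℕ) : Borrow 0 ((a + 1) :: l) (a :: l)
  | skip {j : ℕ} {l l' : List ℕ} : Borrow j l l' → Borrow (j + 1) (0 :: l) (0 :: l')

/-- The covering relation on codes. -/
inductive CodeStep : List ℕ → List ℕ → Prop
  | head {j b : ℕ} {l l' : List ℕ} : j + 1 ≤ b → Borrow j l l' → CodeStep (b :: l) ((b + 1) :: l')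
  | cons (a : ℕ) {l l' : List ℕ} : CodeStep l l' → CodeStep (a :: l) (a :: l')

/-- The order on codes. -/
def CodeLe (l l' : List ℕ) : Prop := Relation.ReflTransGen CodeStep l l'

theorem StrictBallot.ballot {l : List ℕ} (h : StrictBallot l) : Ballot l := by
  induction l with
  | nil => trivial
  | cons a l ih => exact ⟨by have := h.1; omega, ih h.2⟩

theorem Ballot.sum_le {l : List ℕ} (h : Ballot l) : l.sum ≤ l.length := by
  cases l with
  | nil => simp
  | cons a l => simpa using h.1

theorem StrictBallot.sum_lt {l : List ℕ} (h : StrictBallot l) (hl : l ≠ []) :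
    l.sum < l.length := by
  cases l with
  | nil => exact absurd rfl hl
  | cons a l => have := h.1; simp; omega

theorem Ballot.of_append {l₁ l₂ : List ℕ} (h : Ballot (l₁ ++ l₂)) : Ballot l₂ := by
  induction l₁ with
  | nil => exact h
  | cons a l ih => exact ih h.2

theorem StrictBallot.of_append {l₁ l₂ : List ℕ} (h : StrictBallot (l₁ ++ l₂)) :
    StrictBallot l₂ := by
  induction l₁ with
  | nil => exact h
  | cons a l ih => exact ih h.2

theorem ballot_append {l₁ l₂ : List ℕ} (h₂ : l₂.sum = l₂.length) :
    Ballot (l₁ ++ l₂) ↔ Ballot l₁ ∧ Ballot l₂ := by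
  induction l₁ with
  | nil => simp [Ballot]
  | cons a l ih =>
    simp only [List.cons_append, Ballot, ih, List.sum_append, List.length_append, h₂]
    constructor
    · rintro ⟨h, h', h''⟩; exact ⟨⟨by omega, h'⟩, h''⟩
    · rintro ⟨⟨h, h'⟩, h''⟩; exact ⟨by omega, h', h''⟩

theorem isDyckCode_nil : IsDyckCode [] := ⟨trivial, rfl⟩

theorem IsDyckCode.append {l₁ l₂ : List ℕ} (h₁ : IsDyckCode l₁) (h₂ : IsDyckCode l₂) :
    IsDyckCode (l₁ ++ l₂) :=
  ⟨(ballot_append h₂.2).2 ⟨h₁.1, h₂.1⟩, by simp [h₁.2, h₂.2]⟩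

theorem IsPrimeCode.isDyckCode {l : List ℕ} (h : IsPrimeCode l) : IsDyckCode l := by
  obtain ⟨h₁, h₂, h₃⟩ := h
  cases l with
  | nil => exact absurd rfl h₁
  | cons a l => exact ⟨⟨by simpa using h₃.le, h₂.ballot⟩, h₃⟩

/-- The new last entry is a new first up-step, which lifts the whole path by one. -/
theorem strictBallot_append_zero {l : List ℕ} : StrictBallot (l ++ [0]) ↔ Ballot l := by
  induction l with
  | nil => simp [StrictBallot, Ballot]
  | cons a l ih => simp [StrictBallot, Ballot, ih]

theorem length_incHead (l : List ℕ) : (incHead l).length = l.length := by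
  cases l <;> rfl

theorem length_wrap (l : List ℕ) : (wrap l).length = l.length + 1 := by
  simp [wrap, length_incHead]

theorem wrap_cons (a : ℕ) (l : List ℕ) : wrap (a :: l) = (a + 1) :: (l ++ [0]) := rfl

theorem wrap_injective : Function.Injective wrap := by
  intro l l' h
  cases l with
  | nil => cases l' with
    | nil => rfl
    | cons b l' => simp [wrap, incHead] at h
  | cons a l => cases l' with
    | nil => simp [wrap, incHead] at h
    | cons b l' => simpa [wrap, incHead] using h

theorem headD_wrap (l : List ℕ) : (wrap l).headD 0 = l.headD 0 + 1 := by
  cases l <;> simp [wrap, incHead]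

theorem IsDyckCode.isPrimeCode_wrap {l : List ℕ} (h : IsDyckCode l) : IsPrimeCode (wrap l) := by
  cases l with
  | nil => exact ⟨by simp [wrap, incHead], trivial, rfl⟩
  | cons a l =>
    refine ⟨by simp [wrap_cons], strictBallot_append_zero.2 h.1.2, ?_⟩
    have := h.2
    simp [wrap_cons] at this ⊢
    omega

theorem IsPrimeCode.exists_wrap {l : List ℕ} (h : IsPrimeCode l) :
    ∃ q, IsDyckCode q ∧ l = wrap q := by
  obtain ⟨h₁, h₂, h₃⟩ := h
  cases l with
  | nil => exact absurd rfl h₁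
  | cons a l =>
    rcases List.eq_nil_or_concat l with rfl | ⟨l, b, rfl⟩
    · exact ⟨[], isDyckCode_nil, by simp at h₃; simp [h₃, wrap, incHead]⟩
    · have hb : b = 0 := by
        have := (StrictBallot.of_append (l₁ := l) (l₂ := [b]) (by simpa using h₂)).1
        simpa using this
      subst hb
      simp only [List.tail_cons, List.concat_eq_append] at h₂
      have hlt := h₂.sum_lt (by simp)
      simp at h₃ hlt
      obtain ⟨a, rfl⟩ : ∃ a', a = a' + 1 := ⟨a - 1, by omega⟩
      refine ⟨a :: l, ⟨⟨by omega, strictBallot_append_zero.1 h₂⟩, by simp; omega⟩,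
        by simp [wrap_cons]⟩

/-- Every ballot code splits off its longest balanced suffix. -/
theorem Ballot.exists_append {l : List ℕ} (h : Ballot l) :
    ∃ s q, l = s ++ q ∧ StrictBallot s ∧ IsDyckCode q := by
  induction l with
  | nil => exact ⟨[], [], rfl, trivial, isDyckCode_nil⟩
  | cons a l ih =>
    obtain ⟨s, q, rfl, hs, hq⟩ := ih h.2
    by_cases hlt : a + s.sum ≤ s.length
    · exact ⟨a :: s, q, rfl, ⟨hlt, hs⟩, hq⟩
    · refine ⟨[], a :: (s ++ q), rfl, trivial, h, ?_⟩
      have h1 := h.1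
      have h2 := hq.2
      simp at h1 ⊢
      omega

/-- Cutting the tail before its longest balanced suffix isolates the last prime factor of the path.
-/
theorem IsDyckCode.exists_append {l : List ℕ} (h : IsDyckCode l) (hl : l ≠ []) :
    ∃ r q, l = r ++ q ∧ IsPrimeCode r ∧ IsDyckCode q := by
  cases l with
  | nil => exact absurd rfl hl
  | cons a l =>
    obtain ⟨s, q, rfl, hs, hq⟩ := h.1.2.exists_append
    refine ⟨a :: s, q, rfl, ⟨by simp, hs, ?_⟩, hq⟩
    have h1 := h.2
    have h2 := hq.2
    simp at h1 ⊢
    omega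

/-- A nonempty balanced proper suffix would be an interior return to the axis. -/
theorem IsPrimeCode.eq_nil_of_append {r s : List ℕ} (hr : IsPrimeCode (r ++ s)) (hr0 : r ≠ [])
    (hs : s.sum = s.length) : s = [] := by
  by_contra h
  cases r with
  | nil => exact hr0 rfl
  | cons a r => exact ((StrictBallot.of_append hr.2.1).sum_lt h).ne hs

theorem append_inj_of_isPrimeCode {r r' q q' : List ℕ} (hr : IsPrimeCode r) (hr' : IsPrimeCode r')
    (hq : IsDyckCode q) (hq' : IsDyckCode q') (h : r ++ q = r' ++ q') : r = r' ∧ q = q' := by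
  have bal : ∀ {s q q' : List ℕ}, IsDyckCode q → IsDyckCode q' → q' = s ++ q →
      s.sum = s.length := by
    rintro s q q' hq hq' rfl
    have h1 := hq.2
    have h2 := hq'.2
    simp at h2
    omega
  rcases List.append_eq_append_iff.1 h with ⟨s, rfl, h2⟩ | ⟨s, rfl, h2⟩
  · have := hr'.eq_nil_of_append hr.1 (bal hq' hq h2)
    subst this
    simpa using h2
  · have := hr.eq_nil_of_append hr'.1 (bal hq hq' h2)
    subst this
    simpa using h2.symm

/-! ### Steps -/

theorem Borrow.length_eq {j : ℕ} {l l' : List ℕ} (h : Borrow j l l') : l'.length = l.length := by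
  induction h <;> simp_all

theorem Borrow.sum_eq {j : ℕ} {l l' : List ℕ} (h : Borrow j l l') : l'.sum + 1 = l.sum := by
  induction h with
  | here a l => simp; omega
  | skip h ih => simpa using ih

theorem Borrow.ballot {j : ℕ} {l l' : List ℕ} (h : Borrow j l l') (hl : Ballot l) :
    Ballot l' := by
  induction h with
  | here a l => exact ⟨by have := hl.1; omega, hl.2⟩
  | skip h ih => exact ⟨by have := hl.1; have := h.sum_eq; have := h.length_eq; omega, ih hl.2⟩

theorem Borrow.strictBallot {j : ℕ} {l l' : List ℕ} (h : Borrow j l l') (hl : StrictBallot l) :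
    StrictBallot l' := by
  induction h with
  | here a l => exact ⟨by have := hl.1; omega, hl.2⟩
  | skip h ih => exact ⟨by have := hl.1; have := h.sum_eq; have := h.length_eq; omega, ih hl.2⟩

theorem Borrow.append {j : ℕ} {l l' : List ℕ} (h : Borrow j l l') (s : List ℕ) :
    Borrow j (l ++ s) (l' ++ s) := by
  induction h with
  | here a l => exact .here a _
  | skip h ih => exact ih.skip

theorem borrow_replicate (j a : ℕ) (l : List ℕ) :
    Borrow j (List.replicate j 0 ++ (a + 1) :: l) (List.replicate j 0 ++ a :: l) := by
  induction j with
  | zero => exact .here a l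
  | succ j ih => exact ih.skip

theorem Borrow.exists_eq {j : ℕ} {l l' : List ℕ} (h : Borrow j l l') :
    ∃ a s, l = List.replicate j 0 ++ (a + 1) :: s ∧ l' = List.replicate j 0 ++ a :: s := by
  induction h with
  | here a l => exact ⟨a, l, rfl, rfl⟩
  | skip h ih => obtain ⟨a, s, rfl, rfl⟩ := ih; exact ⟨a, s, rfl, rfl⟩

theorem Borrow.of_append {j : ℕ} {r p z : List ℕ} (h : Borrow j (r ++ p) z) :
    (∃ r', Borrow j r r' ∧ z = r' ++ p) ∨
      ∃ t i p', r = List.replicate t 0 ∧ j = t + i ∧ Borrow i p p' ∧ z = r ++ p' := by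
  induction r generalizing j z with
  | nil => exact .inr ⟨0, j, z, rfl, by simp, h, rfl⟩
  | cons a r ih =>
    cases h with
    | here a l => exact .inl ⟨_, .here a r, rfl⟩
    | skip h =>
      rcases ih h with ⟨r', h', rfl⟩ | ⟨t, i, p', rfl, rfl, h', rfl⟩
      · exact .inl ⟨_, h'.skip, rfl⟩
      · exact .inr ⟨t + 1, i, p', rfl, by omega, h', rfl⟩

theorem Borrow.of_append_zero {j : ℕ} {l z : List ℕ} (h : Borrow j (l ++ [0]) z) :
    ∃ l', Borrow j l l' ∧ z = l' ++ [0] := by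
  rcases h.of_append with h | ⟨_, _, _, _, _, h, _⟩
  · exact h
  · cases h with
    | skip h => cases h

theorem CodeStep.length_eq {l l' : List ℕ} (h : CodeStep l l') : l'.length = l.length := by
  induction h with
  | head _ h => simp [h.length_eq]
  | cons a h ih => simp [ih]

theorem CodeStep.sum_eq {l l' : List ℕ} (h : CodeStep l l') : l'.sum = l.sum := by
  induction h with
  | head _ h => have := h.sum_eq; simp; omega
  | cons a h ih => simp [ih]

theorem CodeStep.ballot {l l' : List ℕ} (h : CodeStep l l') (hl : Ballot l) : Ballot l' := by
  induction h with
  | head _ h =>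
    exact ⟨by have := h.sum_eq; have := h.length_eq; have := hl.1; omega, h.ballot hl.2⟩
  | cons a h ih => exact ⟨by rw [h.sum_eq, h.length_eq]; exact hl.1, ih hl.2⟩

theorem CodeStep.strictBallot {l l' : List ℕ} (h : CodeStep l l') (hl : StrictBallot l) :
    StrictBallot l' := by
  induction h with
  | head _ h =>
    exact ⟨by have := h.sum_eq; have := h.length_eq; have := hl.1; omega, h.strictBallot hl.2⟩
  | cons a h ih => exact ⟨by rw [h.sum_eq, h.length_eq]; exact hl.1, ih hl.2⟩

theorem CodeStep.isDyckCode {l l' : List ℕ} (h : CodeStep l l') (hl : IsDyckCode l) :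
    IsDyckCode l' :=
  ⟨h.ballot hl.1, by rw [h.sum_eq, h.length_eq, hl.2]⟩

theorem CodeStep.isPrimeCode {l l' : List ℕ} (h : CodeStep l l') (hl : IsPrimeCode l) :
    IsPrimeCode l' := by
  obtain ⟨-, h₂, h₃⟩ := hl
  refine ⟨?_, ?_, by rw [h.sum_eq, h.length_eq, h₃]⟩
  · cases h <;> simp
  · cases h with
    | head _ h => exact h.strictBallot h₂
    | cons a h => exact h.strictBallot h₂

theorem CodeStep.append_right {l l' : List ℕ} (h : CodeStep l l') (s : List ℕ) :
    CodeStep (l ++ s) (l' ++ s) := by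
  induction h with
  | head hb h => exact .head hb (h.append s)
  | cons a h ih => exact .cons a ih

theorem CodeStep.append_left {l l' : List ℕ} (h : CodeStep l l') (s : List ℕ) :
    CodeStep (s ++ l) (s ++ l') := by
  induction s with
  | nil => exact h
  | cons a s ih => exact .cons a ih

theorem CodeStep.incHead {l l' : List ℕ} (h : CodeStep l l') :
    CodeStep (incHead l) (incHead l') := by
  cases h with
  | head hb h => exact .head (by omega) h
  | cons a h => exact .cons (a + 1) h

theorem CodeLe.length_eq {l l' : List ℕ} (h : CodeLe l l') : l'.length = l.length := by
  induction h with
  | refl => rfl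
  | tail _ h ih => rw [h.length_eq, ih]

theorem CodeLe.isDyckCode {l l' : List ℕ} (h : CodeLe l l') (hl : IsDyckCode l) :
    IsDyckCode l' := by
  induction h with
  | refl => exact hl
  | tail _ h ih => exact h.isDyckCode ih

theorem CodeLe.isPrimeCode {l l' : List ℕ} (h : CodeLe l l') (hl : IsPrimeCode l) :
    IsPrimeCode l' := by
  induction h with
  | refl => exact hl
  | tail _ h ih => exact h.isPrimeCode ih

theorem CodeLe.append {l l' s s' : List ℕ} (h : CodeLe l l') (hs : CodeLe s s') :
    CodeLe (l ++ s) (l' ++ s') :=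
  (Relation.ReflTransGen.lift (· ++ s) (fun _ _ h => h.append_right s) _ _ h).trans
    (Relation.ReflTransGen.lift (l' ++ ·) (fun _ _ h => h.append_left l') _ _ hs)

theorem CodeLe.wrap {l l' : List ℕ} (h : CodeLe l l') : CodeLe (wrap l) (wrap l') :=
  Relation.ReflTransGen.lift DyckInterval.wrap (fun _ _ h => (h.append_right [0]).incHead) _ _ h

/-! ### Intervals below a concatenation -/

/-- Had the borrowed unit come from the balanced part `q₁`, the corresponding suffix of `x` would
have one down-step too many. -/
theorem Borrow.of_append_target {j : ℕ} {x q₂ q₁ : List ℕ} (h : Borrow j x (q₂ ++ q₁))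
    (hx : Ballot x) (hq : q₁.sum = q₁.length) : ∃ x₂, x = x₂ ++ q₁ ∧ Borrow j x₂ q₂ := by
  induction q₂ generalizing j x with
  | nil =>
    have h1 := h.sum_eq
    have h2 := h.length_eq
    have h3 := hx.sum_le
    simp at h1 h2
    omega
  | cons a q ih =>
    cases h with
    | here a l => exact ⟨(a + 1) :: q, rfl, .here a q⟩
    | skip h =>
      obtain ⟨x₂, rfl, h'⟩ := ih h hx.2
      exact ⟨0 :: x₂, rfl, h'.skip⟩

theorem CodeStep.of_append_target {x q₂ q₁ : List ℕ} (h : CodeStep x (q₂ ++ q₁))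
    (hx : Ballot x) (hq : q₁.sum = q₁.length) :
    ∃ x₂ x₁, x = x₂ ++ x₁ ∧ CodeLe x₂ q₂ ∧ CodeLe x₁ q₁ ∧ x₁.sum = x₁.length := by
  induction q₂ generalizing x with
  | nil => exact ⟨[], x, rfl, .refl, .single h, by rw [← h.sum_eq, ← h.length_eq]; exact hq⟩
  | cons a q ih =>
    cases h with
    | head hb h =>
      obtain ⟨x₂, rfl, h'⟩ := h.of_append_target hx.2 hq
      exact ⟨_ :: x₂, q₁, rfl, .single (.head hb h'), .refl, hq⟩
    | cons a h =>
      obtain ⟨x₂, x₁, rfl, h₂, h₁, hs⟩ := ih h hx.2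
      exact ⟨a :: x₂, x₁, rfl,
        Relation.ReflTransGen.lift (a :: ·) (fun _ _ h => h.cons a) _ _ h₂, h₁, hs⟩

theorem CodeLe.of_append_target {x q₂ q₁ : List ℕ} (h : CodeLe x (q₂ ++ q₁))
    (hx : IsDyckCode x) (hq : q₁.sum = q₁.length) :
    ∃ x₂ x₁, x = x₂ ++ x₁ ∧ CodeLe x₂ q₂ ∧ CodeLe x₁ q₁ ∧ IsDyckCode x₂ ∧ IsDyckCode x₁ := by
  have key : ∃ x₂ x₁, x = x₂ ++ x₁ ∧ CodeLe x₂ q₂ ∧ CodeLe x₁ q₁ ∧ x₁.sum = x₁.length := by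
    induction h using Relation.ReflTransGen.head_induction_on with
    | refl => exact ⟨q₂, q₁, rfl, .refl, .refl, hq⟩
    | head h' _ ih =>
      obtain ⟨x₂, x₁, rfl, h₂, h₁, hs⟩ := ih (h'.isDyckCode hx)
      obtain ⟨z₂, z₁, rfl, k₂, k₁, ks⟩ := h'.of_append_target hx.1 hs
      exact ⟨z₂, z₁, rfl, k₂.trans h₂, k₁.trans h₁, ks⟩
  obtain ⟨x₂, x₁, rfl, h₂, h₁, hs⟩ := key
  obtain ⟨b₂, b₁⟩ := (ballot_append hs).1 hx.1
  refine ⟨x₂, x₁, rfl, h₂, h₁, ⟨b₂, ?_⟩, b₁, hs⟩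
  have := hx.2
  simp at this
  omega

/-! ### Intervals below a prime path -/

theorem CodeStep.of_append_zero {l z : List ℕ} (h : CodeStep (l ++ [0]) z) :
    ∃ l', CodeStep l l' ∧ z = l' ++ [0] := by
  induction l generalizing z with
  | nil =>
    cases h with
    | head hb h => omega
    | cons a h => cases h
  | cons a l ih =>
    cases h with
    | head hb h =>
      obtain ⟨l', h', rfl⟩ := h.of_append_zero
      exact ⟨_, .head hb h', rfl⟩
    | cons a h =>
      obtain ⟨l', h', rfl⟩ := ih h
      exact ⟨_, .cons a h', rfl⟩

theorem CodeStep.of_wrap {p z : List ℕ} (h : CodeStep (wrap p) z) (hp : IsDyckCode p) :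
    ∃ p', CodeStep p p' ∧ z = wrap p' := by
  cases p with
  | nil =>
    cases h with
    | head hb h => cases h
    | cons a h => cases h
  | cons a l =>
    cases h with
    | head hb h =>
      rename_i j _
      obtain ⟨l', h', rfl⟩ := h.of_append_zero
      -- The wrapped head only gives `j + 1 ≤ a + 1`. The missing unit comes from balance: the
      -- suffix starting at the borrowed entry has sum at most its length, so the `j + 1` entries
      -- before it, namely `a` and `j` zeros, have sum at least `j + 1`.
      refine ⟨_, .head (j := j) ?_ h', rfl⟩
      obtain ⟨t, s, rfl, rfl⟩ := h'.exists_eq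
      have h1 := hp.1.2.of_append.sum_le
      have h2 := hp.2
      simp at h1 h2
      omega
    | cons a h =>
      obtain ⟨l', h', rfl⟩ := h.of_append_zero
      exact ⟨_, h'.cons a, rfl⟩

theorem CodeLe.of_wrap {p z : List ℕ} (h : CodeLe (DyckInterval.wrap p) z) (hp : IsDyckCode p) :
    ∃ p', CodeLe p p' ∧ z = DyckInterval.wrap p' := by
  induction h with
  | refl => exact ⟨p, .refl, rfl⟩
  | tail _ h ih =>
    obtain ⟨p', hp', rfl⟩ := ih
    obtain ⟨p'', h', rfl⟩ := h.of_wrap (hp'.isDyckCode hp)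
    exact ⟨p'', hp'.tail h', rfl⟩

/-! ### Pyramids and sliding down-steps across them. -/

theorem codeLe_slide {b j : ℕ} (hb : j + 1 ≤ b) {c k : ℕ} (hc : c ≤ k) (w : List ℕ) :
    CodeLe (b :: (List.replicate j 0 ++ k :: w))
      ((b + c) :: (List.replicate j 0 ++ (k - c) :: w)) := by
  induction c with
  | zero => exact .refl
  | succ c ih =>
    refine (ih (by omega)).tail ?_
    have := borrow_replicate j (k - (c + 1)) w
    rw [show k - (c + 1) + 1 = k - c by omega] at this
    exact .head (by omega) this

/-- The pyramid is the largest Dyck path. -/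
theorem IsDyckCode.codeLe_pyramid {n : ℕ} {l : List ℕ} (hl : IsDyckCode l)
    (hn : l.length = n + 1) : CodeLe l ((n + 1) :: List.replicate n 0) := by
  induction n using Nat.strong_induction_on generalizing l with
  | _ n ih =>
    obtain ⟨r, q, rfl, hr, hq⟩ := hl.exists_append (by rintro rfl; simp at hn)
    obtain ⟨s, hs, rfl⟩ := hr.exists_wrap
    have hprime : CodeLe (wrap s) ((s.length + 1) :: List.replicate s.length 0) := by
      rcases hm : s.length with - | m
      · rw [List.length_eq_zero_iff.1 hm]
        exact .refl
      · have := (ih m (by simp [length_wrap] at hn; omega) hs hm).wrap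
        rwa [wrap_cons, ← List.replicate_succ'] at this
    rcases hm : q.length with - | m
    · rw [List.length_eq_zero_iff.1 hm] at hn ⊢
      simp [length_wrap] at hn ⊢
      rwa [hn] at hprime
    · have h1 := hprime.append (ih m (by simp [length_wrap] at hn; omega) hq hm)
      refine h1.trans ?_
      -- Both factors are now pyramids; all `m + 1` down-steps of the earlier one slide across the
      -- later one.
      have h2 := codeLe_slide (b := s.length + 1) le_rfl (le_refl (m + 1)) (List.replicate m 0)
      obtain rfl : n = s.length + (m + 1) := by simp [length_wrap] at hn; omega
      rw [List.replicate_add, show s.length + (m + 1) + 1 = s.length + 1 + (m + 1) by omega]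
      simpa [List.replicate_succ, CodeLe] using h2

/-- The code obtained from `(k :: w)` by inserting a pyramid of semilength `m + 1` before the last
`c` down-steps. -/
def insertPyramid (m c : ℕ) (l : List ℕ) : List ℕ :=
  (m + 1 + c) :: (List.replicate m 0 ++ (l.headD 0 - c) :: l.tail)

theorem codeLe_insertPyramid {r p q : List ℕ} {m c : ℕ} (hr : IsDyckCode r)
    (hm : r.length = m + 1) (hpq : CodeLe p q) (hq : q ≠ []) (hc : c ≤ q.headD 0) :
    CodeLe (r ++ p) (insertPyramid m c q) := by
  refine ((hr.codeLe_pyramid hm).append hpq).trans ?_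
  cases q with
  | nil => exact absurd rfl hq
  | cons k w => exact codeLe_slide le_rfl hc w

/-- As `c ≥ 1`, the pyramid stands above the axis, so it neither creates nor removes a return. -/
theorem isPrimeCode_insertPyramid {m c : ℕ} {q : List ℕ} (hq : q ≠ []) (hc0 : 1 ≤ c)
    (hc : c ≤ q.headD 0) : IsPrimeCode (insertPyramid m c q) ↔ IsPrimeCode q := by
  cases q with
  | nil => exact absurd rfl hq
  | cons k w =>
    simp only [insertPyramid, List.headD_cons, List.tail_cons] at hc ⊢
    constructor
    · rintro ⟨-, h₂, h₃⟩
      refine ⟨by simp, (StrictBallot.of_append h₂).2, ?_⟩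
      simp at h₃ ⊢
      omega
    · rintro ⟨-, h₂, h₃⟩
      simp at h₃
      refine ⟨by simp, ?_, by simp; omega⟩
      simp only [List.tail_cons]
      induction m with
      | zero => exact ⟨by omega, h₂⟩
      | succ m ih => exact ⟨by simp; omega, ih⟩

/-! ### Steps that cross the last prime factor. -/

theorem CodeStep.of_append {r p z : List ℕ} (h : CodeStep (r ++ p) z) :
    (∃ r', CodeStep r r' ∧ z = r' ++ p) ∨ (∃ p', CodeStep p p' ∧ z = r ++ p') ∨
      ∃ s b t i p', r = s ++ b :: List.replicate t 0 ∧ t + i + 1 ≤ b ∧ Borrow i p p' ∧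
        z = s ++ (b + 1) :: (List.replicate t 0 ++ p') := by
  induction r generalizing z with
  | nil => exact .inr (.inl ⟨z, h, rfl⟩)
  | cons a r ih =>
    cases h with
    | head hb h =>
      rcases h.of_append with ⟨r', h', rfl⟩ | ⟨t, i, p', rfl, rfl, h', rfl⟩
      · exact .inl ⟨_, .head hb h', rfl⟩
      · exact .inr (.inr ⟨[], a, t, i, p', rfl, hb, h', rfl⟩)
    | cons a h =>
      rcases ih h with ⟨r', h', rfl⟩ | ⟨p', h', rfl⟩ | ⟨s, b, t, i, p', rfl, hb, h', rfl⟩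
      · exact .inl ⟨_, .cons a h', rfl⟩
      · exact .inr (.inl ⟨p', h', rfl⟩)
      · exact .inr (.inr ⟨a :: s, b, t, i, p', rfl, hb, h', rfl⟩)

/-- In the crossing case `r` ends in `b :: 0^t` with `b ≥ t + 1`. A proper suffix of a prime code
cannot be this heavy, so it is all of `r`, and balance makes `r` a pyramid and the borrow immediate.
-/
theorem CodeStep.of_prime_append {r p z : List ℕ} {m : ℕ} (h : CodeStep (r ++ p) z)
    (hr : IsPrimeCode r) (hm : r.length = m + 1) (hp : IsDyckCode p) :
    (∃ r', CodeStep r r' ∧ z = r' ++ p) ∨ (∃ p', CodeStep p p' ∧ z = r ++ p') ∨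
      (1 ≤ p.headD 0 ∧ z = insertPyramid m 1 p) := by
  rcases h.of_append with h | h | ⟨s, b, t, i, p', rfl, hb, h', rfl⟩
  · exact .inl h
  · exact .inr (.inl h)
  · have hs : s = [] := by
      by_contra hs
      cases s with
      | nil => exact hs rfl
      | cons a s =>
        have := (StrictBallot.of_append hr.2.1).1
        simp at this
        omega
    subst hs
    have h3 := hr.2.2
    simp at h3 hm
    obtain rfl : t = m := by omega
    obtain rfl : b = t + 1 := by omega
    obtain rfl : i = 0 := by omega
    cases h' with
    | here a l => exact .inr (.inr ⟨by simp, by simp [insertPyramid]⟩)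

theorem Borrow.of_replicate_append {m j : ℕ} {p z : List ℕ}
    (h : Borrow j (List.replicate m 0 ++ p) z) :
    ∃ i p', j = m + i ∧ Borrow i p p' ∧ z = List.replicate m 0 ++ p' := by
  induction m generalizing j z with
  | zero => exact ⟨j, z, by simp, h, rfl⟩
  | succ m ih =>
    cases h with
    | skip h =>
      obtain ⟨i, p', rfl, h', rfl⟩ := ih h
      exact ⟨i, p', by omega, h', rfl⟩

theorem CodeStep.of_replicate_append {m : ℕ} {p z : List ℕ}
    (h : CodeStep (List.replicate m 0 ++ p) z) :
    ∃ p', CodeStep p p' ∧ z = List.replicate m 0 ++ p' := by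
  induction m generalizing z with
  | zero => exact ⟨z, h, rfl⟩
  | succ m ih =>
    cases h with
    | head hb h => omega
    | cons _ h =>
      obtain ⟨p', h', rfl⟩ := ih h
      exact ⟨p', h', rfl⟩

theorem CodeStep.of_insertPyramid {m c : ℕ} {q z : List ℕ} (h : CodeStep (insertPyramid m c q) z)
    (hq : q ≠ []) (hc0 : 1 ≤ c) (hc : c ≤ q.headD 0) :
    ∃ c' q', CodeLe q q' ∧ q' ≠ [] ∧ 1 ≤ c' ∧ c' ≤ q'.headD 0 ∧ z = insertPyramid m c' q' := by
  cases q with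
  | nil => exact absurd rfl hq
  | cons k w =>
    simp only [insertPyramid, List.headD_cons, List.tail_cons] at hc h
    cases h with
    | head hb h =>
      obtain ⟨i, p', rfl, h', rfl⟩ := h.of_replicate_append
      generalize hk : k - c = k' at h'
      cases h' with
      | here a l =>
        refine ⟨c + 1, k :: w, .refl, by simp, by omega, by simp; omega, ?_⟩
        simp [insertPyramid]
        omega
      -- Here `k - c = 0`: the whole last run of `q` already follows the pyramid, and the unit comes
      -- from deeper. In `q` this is a step raising `k` to `k + 1`, legal since `hb` gives `j + 1 ≤
      -- c ≤ k`.
      | skip h'' =>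
        rename_i j _
        refine ⟨c + 1, (k + 1) :: _, .single (.head (j := j) (by omega) h''), by simp, by omega,
          by simp; omega, ?_⟩
        simp [insertPyramid]
        omega
    | cons _ h =>
      obtain ⟨p', h', rfl⟩ := h.of_replicate_append
      cases h' with
      | head hb h'' =>
        refine ⟨c, _, .single (.head (b := k) (by omega) h''), by simp, hc0, by simp; omega, ?_⟩
        simp [insertPyramid]
        omega
      | cons _ h'' =>
        exact ⟨c, _, .single (h''.cons k), by simp, hc0, hc, by simp [insertPyramid]⟩

/-- Along a chain the path stays a concatenation until a first crossing, and keeps the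
inserted-pyramid form afterwards. A prime end rules out the first form because the rest is nonempty.
-/
theorem CodeLe.of_prime_append {r p z : List ℕ} {m : ℕ} (h : CodeLe (r ++ p) z)
    (hr : IsPrimeCode r) (hm : r.length = m + 1) (hp : IsDyckCode p) (hp0 : p ≠ [])
    (hz : IsPrimeCode z) :
    ∃ c q, CodeLe p q ∧ IsPrimeCode q ∧ 1 ≤ c ∧ c ≤ q.headD 0 ∧ z = insertPyramid m c q := by
  have key : (∃ r' p', CodeLe r r' ∧ CodeLe p p' ∧ z = r' ++ p') ∨
      ∃ c q, CodeLe p q ∧ q ≠ [] ∧ 1 ≤ c ∧ c ≤ q.headD 0 ∧ z = insertPyramid m c q := by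
    clear hz
    induction h with
    | refl => exact .inl ⟨r, p, .refl, .refl, rfl⟩
    | tail _ h ih =>
      rcases ih with ⟨r', p', hr', hp', rfl⟩ | ⟨c, q, hpq, hq, hc0, hc, rfl⟩
      · rcases h.of_prime_append (hr'.isPrimeCode hr) (hr'.length_eq.trans hm)
          (hp'.isDyckCode hp) with ⟨r'', h', rfl⟩ | ⟨p'', h', rfl⟩ | ⟨h1, rfl⟩
        · exact .inl ⟨_, _, hr'.tail h', hp', rfl⟩
        · exact .inl ⟨_, _, hr', hp'.tail h', rfl⟩
        · exact .inr ⟨1, p', hp', by rintro rfl; simp at h1, le_rfl, h1, rfl⟩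
      · obtain ⟨c', q', hq', h0, h1, h2, rfl⟩ := h.of_insertPyramid hq hc0 hc
        exact .inr ⟨c', q', hpq.trans hq', h0, h1, h2, rfl⟩
  rcases key with ⟨r', p', hr', hp', rfl⟩ | ⟨c, q, hpq, hq, hc0, hc, rfl⟩
  · have h1 := hz.eq_nil_of_append (hr'.isPrimeCode hr).1 (hp'.isDyckCode hp).2
    have := hp'.length_eq
    rw [h1] at this
    exact absurd (List.length_eq_zero_iff.1 this.symm) hp0
  · exact ⟨c, q, hpq, (isPrimeCode_insertPyramid hq hc0 hc).1 hz, hc0, hc, rfl⟩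

open DyckStep

/-! ### Dyck words and their codes -/

/-- The word with a given code. -/
def word : List ℕ → List DyckStep
  | [] => []
  | a :: l => word l ++ U :: List.replicate a D

/-- The effect on the code of appending a step. -/
def pushStep (l : List ℕ) : DyckStep → List ℕ
  | U => 0 :: l
  | D => incHead l

/-- The code of a word that starts with an up-step. -/
def code (w : List DyckStep) : List ℕ := w.foldl pushStep []

theorem foldl_pushStep_replicate_U (k : ℕ) (l : List ℕ) :
    (List.replicate k U).foldl pushStep l = List.replicate k 0 ++ l := by
  induction k generalizing l with
  | zero => rfl
  | succ k ih =>
    rw [List.replicate_succ, List.foldl_cons, ih, List.replicate_succ']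
    simp [pushStep]

theorem foldl_pushStep_replicate_D (k a : ℕ) (l : List ℕ) :
    (List.replicate k D).foldl pushStep (a :: l) = (a + k) :: l := by
  induction k generalizing a with
  | zero => rfl
  | succ k ih =>
    rw [List.replicate_succ, List.foldl_cons, pushStep, incHead, ih]
    congr 1
    omega

theorem code_append (w w' : List DyckStep) : code (w ++ w') = w'.foldl pushStep (code w) :=
  List.foldl_append

theorem code_word (l : List ℕ) : code (word l) = l := by
  induction l with
  | nil => rfl
  | cons a l ih =>
    rw [word, code_append, ih, List.foldl_cons, pushStep, foldl_pushStep_replicate_D, zero_add]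

theorem word_incHead {l : List ℕ} (hl : l ≠ []) : word (incHead l) = word l ++ [D] := by
  cases l with
  | nil => exact absurd rfl hl
  | cons a l => simp [incHead, word, List.replicate_succ']

theorem count_U_word (l : List ℕ) : (word l).count U = l.length := by
  induction l with
  | nil => rfl
  | cons a l ih => simp [word, ih, List.count_replicate]

theorem count_D_word (l : List ℕ) : (word l).count D = l.sum := by
  induction l with
  | nil => rfl
  | cons a l ih => simp [word, ih, add_comm]

/-- `pushStep` discards down-steps that precede every up-step; the prefix condition excludes them,
so `code` loses nothing. -/
theorem word_code_and_ballot {w : List DyckStep} (hw : ∀ v, v <+: w → v.count D ≤ v.count U) :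
    word (code w) = w ∧ Ballot (code w) := by
  induction w using List.reverseRecOn with
  | nil => exact ⟨rfl, trivial⟩
  | append_singleton w s ih =>
    obtain ⟨h1, h2⟩ := ih fun v hv => hw v (hv.trans (List.prefix_append _ _))
    have hs := hw _ (List.prefix_refl _)
    rw [code_append]
    have hU := count_U_word (code w)
    have hD := count_D_word (code w)
    rw [h1] at hU hD
    cases s with
    | U => exact ⟨by simp [pushStep, word, h1], ⟨by have := h2.sum_le; omega, h2⟩⟩
    | D =>
      simp [hU, hD] at hs
      have hne : code w ≠ [] := by rintro h; simp [h] at hs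
      refine ⟨by simp [pushStep, word_incHead hne, h1], ?_⟩
      cases h : code w with
      | nil => exact absurd h hne
      | cons a l =>
        rw [h] at hs h2
        simp at hs
        exact ⟨by omega, h2.2⟩

theorem strictBallot_code {w : List DyckStep}
    (hw : ∀ v, v <+: w → v ≠ [] → v.count D < v.count U) : StrictBallot (code w) := by
  induction w using List.reverseRecOn with
  | nil => trivial
  | append_singleton w s ih =>
    have h2 := ih fun v hv => hw v (hv.trans (List.prefix_append _ _))
    have hs := hw _ (List.prefix_refl _) (by simp)
    have h1 := (word_code_and_ballot (w := w) fun v hv => by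
      rcases eq_or_ne v [] with rfl | h
      · simp
      · exact (hw v (hv.trans (List.prefix_append _ _)) h).le).1
    rw [code_append]
    have hU := count_U_word (code w)
    have hD := count_D_word (code w)
    rw [h1] at hU hD
    cases s with
    | U => exact ⟨by have := h2.ballot.sum_le; omega, h2⟩
    | D =>
      simp [hU, hD] at hs
      cases h : code w with
      | nil => trivial
      | cons a l =>
        rw [h] at hs h2
        simp at hs
        exact ⟨by omega, h2.2⟩

theorem prefix_word_cons {a : ℕ} {l : List ℕ} {v : List DyckStep} (hv : v <+: word (a :: l)) :
    v <+: word l ∨ ∃ i ≤ a, v = word (i :: l) := by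
  induction a generalizing v with
  | zero =>
    rcases List.prefix_concat_iff.1 hv with rfl | h
    · exact .inr ⟨0, le_rfl, rfl⟩
    · exact .inl h
  | succ a ih =>
    have e : word ((a + 1) :: l) = word (a :: l) ++ [D] := word_incHead (l := a :: l) (by simp)
    rw [e] at hv
    rcases List.prefix_concat_iff.1 hv with rfl | h
    · exact .inr ⟨a + 1, le_rfl, e.symm⟩
    · rcases ih h with h | ⟨i, hi, rfl⟩
      · exact .inl h
      · exact .inr ⟨i, by omega, rfl⟩

theorem Ballot.count_le {l : List ℕ} (hl : Ballot l) {v : List DyckStep} (hv : v <+: word l) :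
    v.count D ≤ v.count U := by
  induction l with
  | nil => rw [List.prefix_nil.1 hv]; simp
  | cons a l ih =>
    rcases prefix_word_cons hv with h | ⟨i, hi, rfl⟩
    · exact ih hl.2 h
    · have := hl.1
      rw [count_D_word, count_U_word]
      simp
      omega

theorem StrictBallot.count_lt {l : List ℕ} (hl : StrictBallot l) {v : List DyckStep}
    (hv : v <+: word l) (hv0 : v ≠ []) : v.count D < v.count U := by
  induction l with
  | nil => exact absurd (List.prefix_nil.1 hv) hv0
  | cons a l ih =>
    rcases prefix_word_cons hv with h | ⟨i, hi, rfl⟩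
    · exact ih hl.2 h
    · have := hl.1
      rw [count_D_word, count_U_word]
      simp
      omega

/-- The code of a Dyck word. -/
def dyckCode (P : DyckWord) : List ℕ := code P.toList

theorem count_le_of_prefix (P : DyckWord) {v : List DyckStep} (hv : v <+: P.toList) :
    v.count D ≤ v.count U := by
  rw [List.prefix_iff_eq_take.1 hv]
  exact P.count_D_le_count_U _

theorem word_dyckCode (P : DyckWord) : word (dyckCode P) = P.toList :=
  (word_code_and_ballot fun _ hv => count_le_of_prefix P hv).1

theorem length_dyckCode (P : DyckWord) : (dyckCode P).length = P.semilength := by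
  rw [← count_U_word, word_dyckCode, DyckWord.semilength]

theorem isDyckCode_dyckCode (P : DyckWord) : IsDyckCode (dyckCode P) :=
  ⟨(word_code_and_ballot fun _ hv => count_le_of_prefix P hv).2, by
    rw [← count_D_word, word_dyckCode, length_dyckCode, DyckWord.semilength_eq_count_D]⟩

theorem dyckCode_injective : Function.Injective dyckCode := by
  intro P Q h
  ext1
  rw [← word_dyckCode, h, word_dyckCode]

theorem IsDyckCode.exists_dyckWord {l : List ℕ} (hl : IsDyckCode l) :
    ∃ P : DyckWord, dyckCode P = l :=
  ⟨⟨word l, by rw [count_U_word, count_D_word, hl.2],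
    fun _ => hl.1.count_le (List.take_prefix _ _)⟩, code_word l⟩

theorem isPrime_iff (P : DyckWord) : IsPrime P ↔ IsPrimeCode (dyckCode P) := by
  have hw := word_dyckCode P
  have hd := isDyckCode_dyckCode P
  constructor
  · rintro ⟨h0, h⟩
    have hne : P.toList ≠ [] := DyckWord.toList_ne_nil.2 h0
    have hcn : dyckCode P ≠ [] := by
      intro h
      rw [h] at hw
      exact hne hw.symm
    refine ⟨hcn, ?_, hd.2⟩
    -- Without its last step every nonempty prefix is strictly positive, and that step alters only
    -- the head of the code, on which `IsPrimeCode` imposes no strictness.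
    obtain ⟨w, hw'⟩ : ∃ w, P.toList = w ++ [D] :=
      ⟨P.toList.dropLast, by
        conv_lhs => rw [← List.dropLast_append_getLast hne, P.getLast_eq_D hne]⟩
    have hs : StrictBallot (code w) := strictBallot_code fun v hv hv0 => by
      have hvt : v = P.toList.take v.length :=
        List.prefix_iff_eq_take.1 (hw' ▸ hv.trans (List.prefix_append _ _))
      rw [hvt]
      refine h (List.length_pos_iff.2 hv0) ?_
      have := hv.length_le
      rw [hw']
      simp
      omega
    rw [dyckCode, hw', code_append]
    cases h : code w with
    | nil => trivial
    | cons a l => rw [h] at hs; exact hs.2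
  · rintro ⟨h0, h1, h2⟩
    cases h : dyckCode P with
    | nil => exact absurd h h0
    | cons a l =>
      rw [h] at h1 h2 hw
      refine ⟨?_, fun i hi hi' => ?_⟩
      · rintro rfl
        exact h0 rfl
      · have hp : P.toList.take i <+: word (a :: l) := hw ▸ List.take_prefix _ _
        have hlen : (P.toList.take i).length = i := by simp; omega
        rcases prefix_word_cons hp with h' | ⟨j, hj, hj'⟩
        · refine h1.count_lt h' ?_
          rw [← List.length_pos_iff, hlen]
          exact hi
        · have hja : j ≠ a := by
            rintro rfl
            rw [← hw, ← hj', hlen] at hi'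
            exact lt_irrefl _ hi'
          rw [hj', count_D_word, count_U_word]
          simp at h2 ⊢
          omega

theorem lastDownRun_eq (P : DyckWord) : lastDownRun P = (dyckCode P).headD 0 := by
  rw [lastDownRun, ← word_dyckCode]
  cases dyckCode P with
  | nil => rfl
  | cons a l =>
    rw [word, List.rtakeWhile]
    simp [List.takeWhile_append_of_pos]

/-! ### The order on paths and the order on codes agree. -/

theorem foldl_pushStep_step {l l' : List ℕ} (h : CodeStep l l') (w : List DyckStep) :
    CodeStep (w.foldl pushStep l) (w.foldl pushStep l') := by
  induction w generalizing l l' with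
  | nil => exact h
  | cons s w ih =>
    cases s with
    | U => exact ih (h.cons 0)
    | D => exact ih h.incHead

theorem covers_iff {n : ℕ} (P Q : Path n) :
    Covers P Q ↔ CodeStep (dyckCode P.1) (dyckCode Q.1) := by
  constructor
  · rintro ⟨A, B, k, hk, hP, hQ⟩
    obtain ⟨j, rfl⟩ : ∃ j, k = j + 1 := ⟨k - 1, by omega⟩
    -- Otherwise `A` is empty and `P` starts with a down-step.
    have hA : code A ≠ [] := by
      intro h
      have h1 := count_le_of_prefix P.1 (v := A ++ [D])
        (by rw [hP]; exact ⟨List.replicate (j + 1) U ++ List.replicate (j + 1) D ++ B, by simp⟩)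
      have h2 := (word_code_and_ballot (w := A) fun v hv => count_le_of_prefix P.1
        (hv.trans (by rw [hP, List.append_assoc]; exact List.prefix_append _ _))).1
      rw [h] at h2
      rw [← h2] at h1
      simp [word] at h1
    rw [dyckCode, dyckCode, hP, hQ, code_append, code_append, code_append, code_append]
    refine foldl_pushStep_step ?_ B
    obtain ⟨a, l, hl⟩ := List.exists_cons_of_ne_nil hA
    have h1 := foldl_pushStep_replicate_U (j + 1) (a :: l)
    have h2 := foldl_pushStep_replicate_U (j + 1) ((a + 1) :: l)
    simp only [List.foldl_append, List.foldl_cons, List.foldl_nil, hl, pushStep, incHead, h1, h2]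
    rw [List.replicate_succ (n := j) (a := 0), List.cons_append, List.cons_append,
      foldl_pushStep_replicate_D, foldl_pushStep_replicate_D]
    exact .head (by omega) (borrow_replicate j a l)
  · intro h
    have key : ∀ {l l' : List ℕ}, CodeStep l l' → ∃ (A B : List DyckStep) (k : ℕ), 1 ≤ k ∧
        word l = A ++ ([D] ++ List.replicate k U ++ List.replicate k D) ++ B ∧
        word l' = A ++ (List.replicate k U ++ List.replicate k D ++ [D]) ++ B := by
      intro l l' h
      induction h with
      | @head j b l l' hb h =>
        obtain ⟨a, s, rfl, rfl⟩ := h.exists_eq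
        obtain ⟨d, rfl⟩ := Nat.exists_eq_add_of_le hb
        have hz : ∀ t, word (List.replicate j 0 ++ t) = word t ++ List.replicate j U := by
          intro t
          clear h hb
          induction j with
          | zero => simp
          | succ j ih =>
            rw [List.replicate_succ, List.cons_append, word, ih, List.replicate_succ']
            simp
        -- The `j` zeros and the run `b = j + 1 + d` spell `U^(j+1) D^(j+1) D^d`; the borrowed unit
        -- is the down-step just before.
        refine ⟨word (a :: s), List.replicate d D, j + 1, by omega, ?_, ?_⟩
        · rw [word, hz, show word ((a + 1) :: s) = word (a :: s) ++ [D] from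
            word_incHead (l := a :: s) (by simp), List.replicate_add,
            List.replicate_succ' (n := j) (a := U)]
          simp
        · rw [word, hz, show j + 1 + d + 1 = (j + 1) + (1 + d) by omega, List.replicate_add,
            add_comm 1 d, List.replicate_succ (n := d), List.replicate_succ' (n := j) (a := U)]
          simp
      | cons a h ih =>
        obtain ⟨A, B, k, hk, h1, h2⟩ := ih
        refine ⟨A, B ++ U :: List.replicate a D, k, hk, ?_, ?_⟩
        · rw [word, h1]; simp
        · rw [word, h2]; simp
    have := key h
    rwa [word_dyckCode, word_dyckCode] at this

/-- Chains of codes lift to paths because steps preserve Dyck codes and lengths. -/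
theorem le_iff {n : ℕ} (P Q : Path n) : Le P Q ↔ CodeLe (dyckCode P.1) (dyckCode Q.1) := by
  constructor
  · intro h
    exact Relation.ReflTransGen.lift (fun P : Path n => dyckCode P.1)
      (fun P Q h => (covers_iff P Q).1 h) _ _ h
  · intro h
    generalize hl : dyckCode Q.1 = l at h
    induction h generalizing Q with
    | refl =>
      rw [Subtype.ext (dyckCode_injective hl)]
      exact .refl
    | tail h₁ h₂ ih =>
      have hd := CodeLe.isDyckCode h₁ (isDyckCode_dyckCode P.1)
      obtain ⟨R, rfl⟩ := hd.exists_dyckWord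
      have hR : R.semilength = n := by
        rw [← length_dyckCode, CodeLe.length_eq h₁, length_dyckCode, P.2]
      refine (ih ⟨R, hR⟩ rfl).tail ((covers_iff _ _).2 ?_)
      rw [hl]
      exact h₂

open Finset

/-! ### Counting -/

theorem IsDyckCode.one_le_headD {l : List ℕ} (hl : IsDyckCode l) (h0 : l ≠ []) :
    1 ≤ l.headD 0 := by
  cases l with
  | nil => exact absurd rfl h0
  | cons a l =>
    have h1 := hl.1.2.sum_le
    have h2 := hl.2
    simp at h2 ⊢
    omega

/-- The codes of the Dyck paths of semilength `n`. -/
noncomputable def dyckCodes (n : ℕ) : Finset (List ℕ) :=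
  univ.image fun P : Path n => dyckCode P.1

theorem mem_dyckCodes {n : ℕ} {l : List ℕ} : l ∈ dyckCodes n ↔ IsDyckCode l ∧ l.length = n := by
  simp only [dyckCodes, mem_image, mem_univ, true_and]
  constructor
  · rintro ⟨P, rfl⟩
    exact ⟨isDyckCode_dyckCode _, (length_dyckCode _).trans P.2⟩
  · rintro ⟨h, rfl⟩
    obtain ⟨P, rfl⟩ := h.exists_dyckWord
    exact ⟨⟨P, (length_dyckCode P).symm⟩, rfl⟩

theorem card_dyckCodes (n : ℕ) : #(dyckCodes n) = catalan n := by
  rw [dyckCodes, card_image_of_injective _ fun P Q h => Subtype.ext (dyckCode_injective h),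
    card_univ, DyckWord.card_dyckWord_semilength_eq_catalan]

open Classical in
/-- The intervals between codes of length `n`. -/
noncomputable def codeIntervals (n : ℕ) : Finset (List ℕ × List ℕ) :=
  (dyckCodes n ×ˢ dyckCodes n).filter fun I => CodeLe I.1 I.2

open Classical in
/-- The intervals between codes of length `n` with prime upper end. -/
noncomputable def primeCodeIntervals (n : ℕ) : Finset (List ℕ × List ℕ) :=
  (codeIntervals n).filter fun I => IsPrimeCode I.2

theorem mem_codeIntervals {n : ℕ} {I : List ℕ × List ℕ} :
    I ∈ codeIntervals n ↔ IsDyckCode I.1 ∧ I.1.length = n ∧ CodeLe I.1 I.2 := by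
  simp only [codeIntervals, mem_filter, mem_product, mem_dyckCodes]
  constructor
  · rintro ⟨⟨h1, -⟩, h2⟩
    exact ⟨h1.1, h1.2, h2⟩
  · rintro ⟨h1, h2, h3⟩
    exact ⟨⟨⟨h1, h2⟩, h3.isDyckCode h1, h3.length_eq.trans h2⟩, h3⟩

theorem mem_primeCodeIntervals {n : ℕ} {I : List ℕ × List ℕ} :
    I ∈ primeCodeIntervals n ↔
      IsDyckCode I.1 ∧ I.1.length = n ∧ CodeLe I.1 I.2 ∧ IsPrimeCode I.2 := by
  simp only [primeCodeIntervals, mem_filter, mem_codeIntervals, and_assoc]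

theorem primeCodeIntervals_zero : primeCodeIntervals 0 = ∅ := by
  refine eq_empty_of_forall_notMem fun I hI => ?_
  obtain ⟨-, h1, h2, h3⟩ := mem_primeCodeIntervals.1 hI
  exact h3.1 (List.length_eq_zero_iff.1 (h2.length_eq.trans h1))

theorem codeIntervals_zero : codeIntervals 0 = {([], [])} := by
  ext ⟨p, q⟩
  rw [mem_codeIntervals, mem_singleton, Prod.mk.injEq]
  constructor
  · rintro ⟨-, h1, h2⟩
    exact ⟨List.length_eq_zero_iff.1 h1, List.length_eq_zero_iff.1 (h2.length_eq.trans h1)⟩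
  · rintro ⟨rfl, rfl⟩
    exact ⟨isDyckCode_nil, rfl, .refl⟩

/-! ### Coefficients as weighted sums over code intervals, and their decompositions. -/

/-- The monomial `yᵏ` that records the length `k` of the last run of down-steps. -/
noncomputable def weight (I : List ℕ × List ℕ) : Polynomial ℚ := Polynomial.X ^ I.2.headD 0

theorem sum_monomial_card_eq {n : ℕ} (hn : n ≠ 0) (S : Finset (Path n × Path n)) :
    ∑ k ∈ Icc 1 n, Polynomial.monomial k (#{I ∈ S | lastDownRun I.2.1 = k} : ℚ) =
      ∑ I ∈ S, weight (dyckCode I.1.1, dyckCode I.2.1) := by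
  rw [← sum_fiberwise_of_maps_to (s := S) (t := Icc 1 n) (g := fun I => lastDownRun I.2.1)]
  · refine sum_congr rfl fun k _ => ?_
    rw [sum_congr rfl (g := fun _ => (Polynomial.X ^ k : Polynomial ℚ)), sum_const,
      ← Polynomial.C_mul_X_pow_eq_monomial, nsmul_eq_mul]
    · simp
    · intro I hI
      rw [weight, ← lastDownRun_eq, (mem_filter.1 hI).2]
  · intro I _
    refine mem_Icc.2 ⟨?_, lastDownRun_le I.2⟩
    rw [lastDownRun_eq]
    refine (isDyckCode_dyckCode _).one_le_headD fun h => hn ?_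
    rw [← I.2.2, ← length_dyckCode, h, List.length_nil]

theorem dyckCode_prod_injective (n : ℕ) : Function.Injective
    fun I : Path n × Path n => (dyckCode I.1.1, dyckCode I.2.1) := by
  rintro ⟨P, Q⟩ ⟨P', Q'⟩ h
  simp only [Prod.mk.injEq] at h
  exact Prod.ext (Subtype.ext (dyckCode_injective h.1)) (Subtype.ext (dyckCode_injective h.2))

theorem exists_path_prod {n : ℕ} {I : List ℕ × List ℕ} (h : I ∈ codeIntervals n) :
    ∃ K : Path n × Path n, (dyckCode K.1.1, dyckCode K.2.1) = I := by
  obtain ⟨h1, h2, h3⟩ := mem_codeIntervals.1 h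
  obtain ⟨P, hP⟩ := h1.exists_dyckWord
  obtain ⟨Q, hQ⟩ := (h3.isDyckCode h1).exists_dyckWord
  refine ⟨(⟨P, ?_⟩, ⟨Q, ?_⟩), Prod.ext hP hQ⟩
  · rw [← length_dyckCode, hP, h2]
  · rw [← length_dyckCode, hQ, h3.length_eq, h2]

open Classical in
theorem coeff_one_add_I (n : ℕ) :
    PowerSeries.coeff n (1 + I) = ∑ K ∈ codeIntervals n, weight K := by
  rcases eq_or_ne n 0 with rfl | hn
  · simp [codeIntervals_zero, weight, I]
  · rw [map_add, PowerSeries.coeff_one, if_neg hn, zero_add, I, PowerSeries.coeff_mk]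
    have h := sum_monomial_card_eq hn {K | Le K.1 K.2}
    simp only [filter_filter] at h
    simp only [intervals]
    rw [h]
    refine sum_nbij (fun K => (dyckCode K.1.1, dyckCode K.2.1)) ?_
      (dyckCode_prod_injective n).injOn ?_ fun _ _ => rfl
    · intro K hK
      rw [mem_codeIntervals]
      exact ⟨isDyckCode_dyckCode _, (length_dyckCode _).trans K.1.2,
        (le_iff _ _).1 (mem_filter.1 hK).2⟩
    · intro K hK
      obtain ⟨K, rfl⟩ := exists_path_prod hK
      exact ⟨K, by simpa [le_iff] using (mem_codeIntervals.1 hK).2.2, rfl⟩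

open Classical in
theorem coeff_J_eq_sum (n : ℕ) :
    PowerSeries.coeff n J = ∑ K ∈ primeCodeIntervals n, weight K := by
  rcases eq_or_ne n 0 with rfl | hn
  · simp [primeCodeIntervals_zero, J]
  · rw [J, PowerSeries.coeff_mk]
    have h := sum_monomial_card_eq hn {K | Le K.1 K.2 ∧ IsPrime K.2.1}
    simp only [filter_filter, and_assoc] at h
    simp only [primeIntervals]
    rw [h]
    refine sum_nbij (fun K => (dyckCode K.1.1, dyckCode K.2.1)) ?_
      (dyckCode_prod_injective n).injOn ?_ fun _ _ => rfl
    · intro K hK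
      rw [mem_primeCodeIntervals]
      exact ⟨isDyckCode_dyckCode _, (length_dyckCode _).trans K.1.2,
        (le_iff _ _).1 (mem_filter.1 hK).2.1, (isPrime_iff _).1 (mem_filter.1 hK).2.2⟩
    · intro K hK
      obtain ⟨K, rfl⟩ := exists_path_prod (mem_filter.1 hK).1
      exact ⟨K, by simpa [le_iff, isPrime_iff] using (mem_primeCodeIntervals.1 hK).2.2, rfl⟩

/-- Splits at the last prime factor of the upper path. That factor carries the last run, so the rest
enters only through its number of intervals. -/
theorem sum_codeIntervals {n : ℕ} (hn : n ≠ 0) :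
    ∑ K ∈ codeIntervals n, weight K =
      ∑ p ∈ antidiagonal n, (∑ K ∈ primeCodeIntervals p.1, weight K) * #(codeIntervals p.2) := by
  have : ∀ p ∈ antidiagonal n,
      (∑ K ∈ primeCodeIntervals p.1, weight K) * #(codeIntervals p.2) =
        ∑ K ∈ primeCodeIntervals p.1 ×ˢ codeIntervals p.2, weight K.1 := by
    intro p _
    rw [sum_product, sum_mul]
    simp [mul_comm]
  rw [sum_congr rfl this, sum_sigma']
  symm
  refine sum_nbij (fun a => (a.2.1.1 ++ a.2.2.1, a.2.1.2 ++ a.2.2.2)) ?_ ?_ ?_ ?_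
  · rintro ⟨⟨i, j⟩, ⟨⟨p, r⟩, ⟨p', q⟩⟩⟩ ha
    simp only [mem_sigma, HasAntidiagonal.mem_antidiagonal, mem_product, mem_primeCodeIntervals,
      mem_codeIntervals] at ha ⊢
    obtain ⟨rfl, ⟨h1, rfl, h2, -⟩, h3, rfl, h4⟩ := ha
    exact ⟨h1.append h3, by simp, h2.append h4⟩
  · rintro ⟨⟨i, j⟩, ⟨⟨p, r⟩, ⟨p', q⟩⟩⟩ ha ⟨⟨i', j'⟩, ⟨⟨s, t⟩, ⟨s', u⟩⟩⟩ hb hab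
    simp only [coe_sigma, Set.mem_sigma_iff, mem_coe, HasAntidiagonal.mem_antidiagonal, mem_product,
      mem_primeCodeIntervals, mem_codeIntervals, Prod.mk.injEq] at ha hb hab
    obtain ⟨-, ⟨h1, rfl, h2, h2'⟩, h3, rfl, h4⟩ := ha
    obtain ⟨-, ⟨k1, rfl, k2, k2'⟩, k3, rfl, k4⟩ := hb
    obtain ⟨rfl, rfl⟩ := append_inj_of_isPrimeCode h2' k2' (h4.isDyckCode h3) (k4.isDyckCode k3)
      hab.2
    obtain ⟨rfl, rfl⟩ := List.append_inj hab.1 (h2.length_eq.symm.trans k2.length_eq)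
    rfl
  · rintro ⟨x, z⟩ hx
    obtain ⟨h1, h2, h3⟩ := mem_codeIntervals.1 hx
    have hz := h3.length_eq
    dsimp only at h1 h2 h3 hz
    obtain ⟨r, q, rfl, hr, hq⟩ := (h3.isDyckCode h1).exists_append (by
      rintro rfl
      exact hn (h2.symm.trans hz.symm))
    obtain ⟨p, p', rfl, k1, k2, k3, k4⟩ := h3.of_append_target h1 hq.2
    refine ⟨⟨(p.length, p'.length), ((p, r), (p', q))⟩, ?_, rfl⟩
    exact mem_sigma.2 ⟨HasAntidiagonal.mem_antidiagonal.2 (by simpa using h2), mem_product.2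
      ⟨mem_primeCodeIntervals.2 ⟨k3, rfl, k1, hr⟩, mem_codeIntervals.2 ⟨k4, rfl, k2⟩⟩⟩
  · rintro ⟨⟨i, j⟩, ⟨⟨p, r⟩, ⟨p', q⟩⟩⟩ ha
    simp only [mem_sigma, mem_product, mem_primeCodeIntervals] at ha
    obtain ⟨a, l, hl⟩ := List.exists_cons_of_ne_nil ha.2.1.2.2.2.1
    simp [weight, hl]

open Classical in
theorem sum_primeCodeIntervals_prime (n : ℕ) :
    ∑ K ∈ primeCodeIntervals (n + 1) with IsPrimeCode K.1, weight K =
      Polynomial.X * ∑ K ∈ codeIntervals n, weight K := by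
  rw [mul_sum]
  symm
  refine sum_nbij (fun K => (wrap K.1, wrap K.2)) ?_ ?_ ?_ ?_
  · intro K hK
    obtain ⟨h1, h2, h3⟩ := mem_codeIntervals.1 hK
    rw [mem_filter, mem_primeCodeIntervals]
    exact ⟨⟨h1.isPrimeCode_wrap.isDyckCode, by simp [length_wrap, h2], h3.wrap,
      (h3.isDyckCode h1).isPrimeCode_wrap⟩, h1.isPrimeCode_wrap⟩
  · rintro ⟨p, q⟩ - ⟨p', q'⟩ - h
    simp only [Prod.mk.injEq] at h
    exact Prod.ext (wrap_injective h.1) (wrap_injective h.2)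
  · rintro ⟨x, z⟩ hx
    obtain ⟨hx, hx'⟩ := mem_filter.1 hx
    obtain ⟨h1, h2, h3, h4⟩ := mem_primeCodeIntervals.1 hx
    dsimp only at hx' h1 h2 h3 h4
    obtain ⟨p, hp, rfl⟩ := hx'.exists_wrap
    obtain ⟨q, hq, rfl⟩ := h3.of_wrap hp
    refine ⟨(p, q), mem_codeIntervals.2 ⟨hp, ?_, hq⟩, rfl⟩
    simpa [length_wrap] using h2
  · intro K _
    rw [weight, weight, headD_wrap, pow_succ']

open Classical in
-- The last prime factor of the lower path is the wrap of any Dyck path of semilength `p.1`. The new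
-- last run is `p.1 + 1` from the pyramid plus `c + 1` from `q`, with `c` counted from zero.
theorem sum_primeCodeIntervals_not_prime (n : ℕ) :
    ∑ K ∈ primeCodeIntervals (n + 1) with ¬ IsPrimeCode K.1, weight K =
      ∑ p ∈ antidiagonal n, (Polynomial.X ^ p.1 * (catalan p.1 : Polynomial ℚ)) *
        (Polynomial.X ^ 2 *
          ∑ K ∈ primeCodeIntervals p.2, ∑ c ∈ range (K.2.headD 0), Polynomial.X ^ c) := by
  have : ∀ p ∈ antidiagonal n, (Polynomial.X ^ p.1 * (catalan p.1 : Polynomial ℚ)) *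
      (Polynomial.X ^ 2 *
        ∑ K ∈ primeCodeIntervals p.2, ∑ c ∈ range (K.2.headD 0), Polynomial.X ^ c) =
        ∑ a ∈ dyckCodes p.1 ×ˢ (primeCodeIntervals p.2).sigma fun K => range (K.2.headD 0),
          Polynomial.X ^ (p.1 + 1 + (a.2.2 + 1)) := by
    intro p _
    rw [sum_product]
    dsimp only
    rw [sum_const, card_dyckCodes, sum_sigma', nsmul_eq_mul, mul_comm (_ ^ _),
      mul_assoc, mul_sum, mul_sum]
    congr 1
    refine sum_congr rfl fun a _ => ?_
    ring
  rw [sum_congr rfl this, sum_sigma']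
  symm
  refine sum_nbij (fun a => (wrap a.2.1 ++ a.2.2.1.1, insertPyramid a.1.1 (a.2.2.2 + 1) a.2.2.1.2))
    ?_ ?_ ?_ ?_
  · rintro ⟨⟨i, j⟩, ⟨r, ⟨⟨p, q⟩, c⟩⟩⟩ ha
    simp only [mem_sigma, HasAntidiagonal.mem_antidiagonal, mem_product,
      mem_primeCodeIntervals, mem_dyckCodes, mem_range, mem_filter] at ha ⊢
    obtain ⟨rfl, ⟨h1, rfl⟩, ⟨h2, rfl, h3, h4⟩, h5⟩ := ha
    refine ⟨⟨h1.isPrimeCode_wrap.isDyckCode.append h2, by simp [length_wrap]; omega,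
      codeLe_insertPyramid h1.isPrimeCode_wrap.isDyckCode (length_wrap r) h3 h4.1 h5,
      (isPrimeCode_insertPyramid h4.1 (by omega) h5).2 h4⟩, fun h => ?_⟩
    have := h.eq_nil_of_append h1.isPrimeCode_wrap.1 h2.2
    subst this
    exact h4.1 (List.length_eq_zero_iff.1 h3.length_eq)
  · rintro ⟨⟨i, j⟩, ⟨r, ⟨⟨p, q⟩, c⟩⟩⟩ ha ⟨⟨i', j'⟩, ⟨r', ⟨⟨p', q'⟩, c'⟩⟩⟩ hb hab
    simp only [coe_sigma, Set.mem_sigma_iff, mem_coe, HasAntidiagonal.mem_antidiagonal,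
      mem_product, mem_sigma,
      mem_primeCodeIntervals, mem_dyckCodes, mem_range, Prod.mk.injEq] at ha hb hab
    obtain ⟨-, ⟨h1, rfl⟩, ⟨h2, rfl, h3, h4⟩, h5⟩ := ha
    obtain ⟨-, ⟨k1, rfl⟩, ⟨k2, rfl, k3, k4⟩, k5⟩ := hb
    obtain ⟨hr, rfl⟩ := append_inj_of_isPrimeCode h1.isPrimeCode_wrap k1.isPrimeCode_wrap h2 k2
      hab.1
    obtain rfl := wrap_injective hr
    obtain ⟨a, l, rfl⟩ := List.exists_cons_of_ne_nil h4.1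
    obtain ⟨a', l', rfl⟩ := List.exists_cons_of_ne_nil k4.1
    have h6 := hab.2
    simp [insertPyramid] at h6 h5 k5
    obtain ⟨rfl, h7, rfl⟩ := h6
    obtain rfl : a = a' := by omega
    rfl
  · rintro ⟨x, z⟩ hx
    obtain ⟨hx, hx'⟩ := mem_filter.1 hx
    obtain ⟨h1, h2, h3, h4⟩ := mem_primeCodeIntervals.1 hx
    dsimp only at hx' h1 h2 h3 h4
    obtain ⟨r, p, rfl, hr, hp⟩ := h1.exists_append (by rintro rfl; simp at h2)
    have hp0 : p ≠ [] := by
      rintro rfl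
      rw [List.append_nil] at hx'
      exact hx' hr
    obtain ⟨s, hs, rfl⟩ := hr.exists_wrap
    obtain ⟨c, q, hpq, hq, hc0, hc, rfl⟩ := h3.of_prime_append hr (length_wrap s) hp hp0 h4
    refine ⟨⟨(s.length, p.length), ⟨s, ⟨(p, q), c - 1⟩⟩⟩, ?_, ?_⟩
    · refine mem_sigma.2 ⟨HasAntidiagonal.mem_antidiagonal.2 ?_,
        mem_product.2 ⟨mem_dyckCodes.2 ⟨hs, rfl⟩, mem_sigma.2 ⟨mem_primeCodeIntervals.2 ⟨hp, rfl, hpq, hq⟩, mem_range.2 ?_⟩⟩⟩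
      swap
      · exact lt_of_lt_of_le (Nat.sub_lt hc0 one_pos) hc
      simp [length_wrap] at h2
      change s.length + p.length = n
      omega
    · simp [Nat.sub_add_cancel hc0]
  · rintro a -
    rfl

/-! ### The functional equations -/

/-- The divided difference `(J(x,y) - J(x,1)) / (y - 1)`. -/
noncomputable def dividedDifference : PowerSeries (Polynomial ℚ) :=
  PowerSeries.mk fun n =>
    ∑ K ∈ primeCodeIntervals n, ∑ c ∈ range (K.2.headD 0), Polynomial.X ^ c

theorem coeff_lift_atOne (F : PowerSeries (Polynomial ℚ)) (n : ℕ) :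
    PowerSeries.coeff n (lift (atOne F)) =
      Polynomial.C ((PowerSeries.coeff n F).eval 1) := by
  simp [lift, atOne]

theorem dividedDifference_mul : dividedDifference * (y - 1) = J - lift (atOne J) := by
  ext1 n
  rw [y, ← map_one (PowerSeries.C (R := Polynomial ℚ)), ← map_sub, PowerSeries.coeff_mul_C,
    map_sub, coeff_lift_atOne, coeff_J_eq_sum, dividedDifference, PowerSeries.coeff_mk, sum_mul]
  simp [geom_sum_mul, weight, Polynomial.eval_finsetSum]

theorem coeff_Cxy (n : ℕ) :
    PowerSeries.coeff n Cxy = Polynomial.X ^ n * (catalan n : Polynomial ℚ) := by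
  simp [Cxy, PowerSeries.coeff_rescale]

theorem J_eq : J = x * y + x * y * I + dividedDifference * Cxy * x * y ^ 2 := by
  classical
  have h : x * y + x * y * I + dividedDifference * Cxy * x * y ^ 2 =
      PowerSeries.X * (PowerSeries.C Polynomial.X * (1 + I) +
        Cxy * (PowerSeries.C (Polynomial.X ^ 2) * dividedDifference)) := by
    rw [x, y, map_pow]
    ring
  rw [h]
  ext1 n
  rw [coeff_J_eq_sum]
  cases n with
  | zero => simp [primeCodeIntervals_zero]
  | succ n =>
    rw [PowerSeries.coeff_succ_X_mul, map_add, PowerSeries.coeff_C_mul, coeff_one_add_I,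
      ← sum_filter_add_sum_filter_not _ fun K => IsPrimeCode K.1, sum_primeCodeIntervals_prime,
      sum_primeCodeIntervals_not_prime, PowerSeries.coeff_mul]
    simp only [coeff_Cxy, PowerSeries.coeff_C_mul, dividedDifference, PowerSeries.coeff_mk]

theorem I_eq : I = J * (1 + lift (atOne I)) := by
  have h : ∀ n, PowerSeries.coeff n (1 + lift (atOne I)) = (#(codeIntervals n) : Polynomial ℚ) := by
    intro n
    have := coeff_lift_atOne (1 + I) n
    rw [map_add, map_add, map_one, map_one] at this
    rw [this, coeff_one_add_I]
    simp [weight, Polynomial.eval_finsetSum]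
  ext1 n
  rw [PowerSeries.coeff_mul]
  simp only [h, coeff_J_eq_sum]
  rcases eq_or_ne n 0 with rfl | hn
  · simp [primeCodeIntervals_zero, I]
  · rw [← sum_codeIntervals hn, ← coeff_one_add_I, map_add, PowerSeries.coeff_one, if_neg hn,
      zero_add]

theorem atOne_lift (F : PowerSeries ℚ) : atOne (lift F) = F := by
  ext n
  simp [atOne, lift]

/-- At `y = 1`, `I_eq` says that `1 + I(x,1)` is inverse to `1 - J(x,1)`. -/
theorem I_mul_eq : I * (1 - lift (atOne J)) = J := by
  have h := congrArg lift (congrArg atOne I_eq)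
  rw [map_mul, map_add, map_one, atOne_lift, map_mul, map_add, map_one] at h
  linear_combination (1 - lift (atOne J)) * I_eq + J * h

/-! ### Solving the functional equations -/

/-- The kernel equation for the explicit solution, with the denominator `1 - 2TC - xC³` cleared. -/
theorem kernel_identity {R : Type*} [CommRing R] {x y C T : R} (hx : x = T * (1 - 2 * T))
    (hC : C = 1 + x * y * C ^ 2) :
    (C - 1) * (1 - T) * (1 - 2 * T * C) *
        ((y - 1) * (1 - T) - x * y * (y - 1) - C * x * y ^ 2 * (1 - T)) =
      (1 - T) * (x * y * (y - 1) - T * C * x * y ^ 2) * (1 - 2 * T * C - x * C ^ 3) := by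
  subst hx
  linear_combination (1 - T) * (-(1 - 2 * T * C) * (1 - T) +
    (1 - T - (3 * T - 4 * T ^ 2) * C + (T ^ 2 - 2 * T ^ 3) * C ^ 2) * y) * hC

theorem Cxy_eq : Cxy = 1 + x * y * Cxy ^ 2 := by
  have h := congrArg (PowerSeries.rescale (Polynomial.X : Polynomial ℚ))
    (congrArg (PowerSeries.map (Nat.castRingHom (Polynomial ℚ)))
      PowerSeries.catalanSeries_sq_mul_X_add_one)
  simp only [map_add, map_mul, map_pow, map_one, PowerSeries.map_X, PowerSeries.rescale_X] at h
  rw [← Cxy] at h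
  rw [x, y]
  linear_combination -h

theorem atOne_x : atOne x = PowerSeries.X := by simp [atOne, x]

theorem atOne_y : atOne y = 1 := by simp [atOne, y]

/-- The series `(1 - √(1 - 8x)) / 4`. -/
noncomputable def diagonal : PowerSeries ℚ := PowerSeries.C (1 / 4 : ℚ) * (1 - sqrtOneSubEightX)

theorem X_eq_diagonal : (PowerSeries.X : PowerSeries ℚ) = diagonal * (1 - 2 * diagonal) := by
  have h : PowerSeries.C (1 / 4 : ℚ) * 4 = 1 := by
    rw [← map_ofNat (PowerSeries.C (R := ℚ)) 4, ← map_mul]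
    norm_num
  have h2 := sqrtOneSubEightX_sq
  set c := PowerSeries.C (1 / 4 : ℚ)
  rw [diagonal]
  linear_combination 2 * c ^ 2 * h2 +
    (-PowerSeries.X * (c * 4 + 1) + c * (1 - sqrtOneSubEightX)) * h

theorem constantCoeff_diagonal : PowerSeries.constantCoeff diagonal = 0 := by
  simp [diagonal, constantCoeff_sqrtOneSubEightX]

theorem x_eq_lift : x = lift PowerSeries.X := by simp [lift, x]

theorem constantCoeff_lift (F : PowerSeries ℚ) :
    PowerSeries.constantCoeff (lift F) = Polynomial.C (PowerSeries.constantCoeff F) := by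
  simp only [lift, ← PowerSeries.coeff_zero_eq_constantCoeff_apply, PowerSeries.coeff_map]

theorem constantCoeff_x : PowerSeries.constantCoeff x = 0 := by simp [x]

theorem constantCoeff_y : PowerSeries.constantCoeff y = Polynomial.X := by simp [y]

/-- An explicit solution of the kernel equation. -/
theorem exists_solution : ∃ F : PowerSeries (Polynomial ℚ),
    atOne F = diagonal ∧ x ∣ F ∧
      F * ((y - 1) * (1 - lift diagonal) - x * y * (y - 1) -
        Cxy * x * y ^ 2 * (1 - lift diagonal)) =
      (1 - lift diagonal) * (x * y * (y - 1) - lift diagonal * Cxy * x * y ^ 2) := by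
  set T := lift diagonal with hT
  have hx : x = T * (1 - 2 * T) := by
    rw [x_eq_lift, X_eq_diagonal]
    simp [hT, map_ofNat]
  have hden : PowerSeries.constantCoeff (1 - 2 * T * Cxy - x * Cxy ^ 3) = 1 := by
    simp [hT, constantCoeff_lift, constantCoeff_diagonal, constantCoeff_x]
  have hunit : IsUnit (1 - 2 * T * Cxy - x * Cxy ^ 3) := by
    rw [PowerSeries.isUnit_iff_constantCoeff, hden]
    exact isUnit_one
  obtain ⟨v, hv⟩ := hunit.exists_right_inv
  refine ⟨(Cxy - 1) * (1 - T) * (1 - 2 * T * Cxy) * v, ?_, ?_, ?_⟩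
  · have h1 := congrArg atOne hv
    have h2 := congrArg atOne Cxy_eq
    have h3 := X_eq_diagonal
    simp only [map_sub, map_add, map_mul, map_pow, map_one, map_ofNat, atOne_x, atOne_y, hT,
      atOne_lift] at h1 h2 ⊢
    linear_combination diagonal * h1 + atOne v * (1 - diagonal * atOne Cxy) * h2 +
      atOne v * atOne Cxy ^ 2 * h3
  · refine Dvd.dvd.mul_right (Dvd.dvd.mul_right (Dvd.dvd.mul_right ?_ _) _) _
    exact ⟨y * Cxy ^ 2, by linear_combination Cxy_eq⟩
  · have h := kernel_identity hx Cxy_eq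
    linear_combination v * h +
      (1 - T) * (x * y * (y - 1) - T * Cxy * x * y ^ 2) * hv

theorem y_sub_one_ne_zero : y - 1 ≠ 0 := by
  intro h
  have := congrArg PowerSeries.constantCoeff h
  rw [map_sub, constantCoeff_y, map_one, map_zero] at this
  exact Polynomial.X_sub_C_ne_zero (1 : ℚ) (by simpa using this)

theorem constantCoeff_J : PowerSeries.constantCoeff J = 0 := by
  rw [← PowerSeries.coeff_zero_eq_constantCoeff_apply, J, PowerSeries.coeff_mk]
  simp

theorem constantCoeff_lift_atOne_J : PowerSeries.constantCoeff (lift (atOne J)) = 0 := by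
  rw [constantCoeff_lift, ← PowerSeries.coeff_zero_eq_constantCoeff_apply, atOne,
    PowerSeries.coeff_map, PowerSeries.coeff_zero_eq_constantCoeff_apply, constantCoeff_J]
  simp

theorem J_kernel : J * ((y - 1) * (1 - lift (atOne J)) - x * y * (y - 1) -
      Cxy * x * y ^ 2 * (1 - lift (atOne J))) =
    (1 - lift (atOne J)) * (x * y * (y - 1) - lift (atOne J) * Cxy * x * y ^ 2) := by
  linear_combination (y - 1) * (1 - lift (atOne J)) * J_eq + x * y * (y - 1) * I_mul_eq +
    (1 - lift (atOne J)) * Cxy * x * y ^ 2 * dividedDifference_mul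

theorem X_pow_dvd_lift_atOne {n : ℕ} {F : PowerSeries (Polynomial ℚ)} (h : x ^ n ∣ F) :
    x ^ n ∣ lift (atOne F) := by
  have := map_dvd lift (map_dvd atOne h)
  rwa [map_pow, map_pow, atOne_x, ← x_eq_lift] at this

/-- Subtract the kernel equations of `J` and of the explicit `F = x * g`. Apart from `(y - 1)(1 -
J(x,1))(J - F)`, every term has a factor `x` besides `J - F` or `J(x,1) - T`; for the term `(y - 1)
F (J(x,1) - T)` this factor comes from `x ∣ F`. So agreement modulo `x^n` improves to `x^(n+1)`. -/
theorem atOne_J : atOne J = diagonal := by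
  obtain ⟨F, hF, ⟨g, rfl⟩, hK⟩ := exists_solution
  suffices h : ∀ n, x ^ n ∣ J - x * g by
    have : J - x * g = 0 := by
      ext1 n
      exact PowerSeries.X_pow_dvd_iff.1 (h (n + 1)) n n.lt_succ_self
    rw [sub_eq_zero.1 this, hF]
  intro n
  induction n with
  | zero => simp
  | succ n ih =>
    have ih' := X_pow_dvd_lift_atOne ih
    rw [map_sub, map_sub, hF] at ih'
    have hprime : Prime x := PowerSeries.X_prime
    -- Its constant term in `x` is `y - 1`; it is not a unit, but `x` is prime and can be cancelled
    -- against it.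
    have hnd : ¬ x ∣ (y - 1) * (1 - lift (atOne J)) := by
      intro h
      have := PowerSeries.X_dvd_iff.1 h
      rw [map_mul, map_sub, map_sub, map_one, constantCoeff_y, constantCoeff_lift_atOne_J,
        sub_zero, mul_one] at this
      exact Polynomial.X_sub_C_ne_zero (1 : ℚ) (by simpa using this)
    refine hprime.pow_dvd_of_dvd_mul_left _ hnd ?_
    obtain ⟨E, hE⟩ := ih
    obtain ⟨e, he⟩ := ih'
    have hJ := J_kernel
    set J₁ := lift (atOne J)
    set T := lift diagonal
    -- The remaining terms of the subtracted equations, divided by `x^(n+1)`.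
    refine ⟨(y - 1) * g * e + E * y * (y - 1) + Cxy * y ^ 2 * (E * (1 - J₁) - x * g * e) -
      e * y * (y - 1) - Cxy * y ^ 2 * e * (1 - J₁ - T), ?_⟩
    rw [pow_succ]
    linear_combination hJ - hK +
      (x * y * (y - 1) + Cxy * x * y ^ 2 * (1 - J₁)) * hE +
      ((y - 1) * x * g - Cxy * x * y ^ 2 * (x * g) - x * y * (y - 1) -
        Cxy * x * y ^ 2 * (1 - J₁ - T)) * he

end DyckInterval

open DyckInterval in
/-- All identities hold in the integral domain `ℚ[y]⟦x⟧`; a quotient `A = N / M` is stated as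
`M ≠ 0` together with `A * M = N`. -/
theorem mainTheorem3 :
    -- `J(x,1) = (1 - √(1 - 8x)) / 4`
    atOne J = PowerSeries.C (1 / 4 : ℚ) * (1 - sqrtOneSubEightX) ∧
    -- the explicit rational expression for `J(x,y)`
    (let J₁ := lift (atOne J)
     let num := x * y * (-1 + J₁) * (J₁ * Cxy * y - y + 1)
     let den := J₁ * Cxy * x * y ^ 2 - Cxy * x * y ^ 2 - x * y ^ 2 - J₁ * y + x * y + J₁ + y - 1
     den ≠ 0 ∧ J * den = num) ∧
    -- `I(x,y) = J(x,y) / (1 - J(x,1))`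
    (1 - lift (atOne J) ≠ 0 ∧ I * (1 - lift (atOne J)) = J) ∧
    -- `J(x,y) = xy + xy I(x,y) + (J(x,y) - J(x,1)) / (y - 1) * C(xy) x y²`, where the
    -- divided difference is the series `Δ`
    (y - 1 ≠ 0 ∧ ∃ Δ : PowerSeries (Polynomial ℚ), Δ * (y - 1) = J - lift (atOne J) ∧
      J = x * y + x * y * I + Δ * Cxy * x * y ^ 2) := by
  refine ⟨atOne_J, ⟨fun h => ?_, ?_⟩, ⟨fun h => ?_, I_mul_eq⟩, y_sub_one_ne_zero,
    dividedDifference, dividedDifference_mul, J_eq⟩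
  · have := congrArg PowerSeries.constantCoeff h
    simp only [map_sub, map_add, map_mul, map_pow, map_one, map_zero, constantCoeff_x,
      constantCoeff_y, constantCoeff_lift_atOne_J] at this
    exact Polynomial.X_sub_C_ne_zero (1 : ℚ) (by simpa using this)
  · linear_combination J_kernel
  · have := congrArg PowerSeries.constantCoeff h
    rw [map_sub, map_one, constantCoeff_lift_atOne_J] at this
    simp at this
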